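/- Let $p$ be an odd prime. A group is called UCS if it has exactly one non-trivial proper characteristic subgroup. Let $G$ be a non-abelian finite $p$-group of exponent $p^2$ that is UCS, and let $\Phi(G)$ be its Frattini subgroup. Then $G/\Phi(G)$ is elementary abelian, so it is an $\mathbb{F}_p$-vector space, and $g\Phi(G)\mapsto g^p$ is a well-defined isomorphism $G/\Phi(G)\to\Phi(G)$; for $h\in\Phi(G)$ denote by $h^{1/p}\in G/\Phi(G)$ its preimage. Let $\mathcal{L}(G)$ be the (not necessarily associative) $\mathbb{F}_p$-algebra on the vector space $G/\Phi(G)$ with the well-defined bilinear product of $x\Phi(G)$ and $y\Phi(G)$ equal to $[x,y]^{1/p}$, where $[x,y]=x^{-1}y^{-1}xy$. An algebra is called simple if it is non-zero and its only ideals are $0$ and itself. A subgroup $N\le G$ is called powerfully embedded in $G$ if $[N,G]\le N^p$, where $N^p$ is the subgroup generated by the $p$-th powers of elements of $N$. The following are equivalent: (a) $G$ is not isomorphic to a direct power $H^{\times k}$ with $H$ a UCS $p$-group and $k\ge 2$; (b) $G$ has no powerfully embedded proper subgroup $N$ such that $\Phi(G)<N$ (strict inclusion); (c) $\mathcal{L}(G)$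 is a simple algebra. -/

import Mathlib

universe u

/-- A group is UCS if it has exactly one non-trivial proper characteristic subgroup. -/
def IsUCS (G : Type*) [Group G] : Prop :=
  ∃! N : Subgroup G, N.Characteristic ∧ N ≠ ⊥ ∧ N ≠ ⊤

/-- `G` is a finite UCS `p`-group of exponent `p ^ 2`, where `p` is an odd prime. -/
class IsOddUCSExpSq (p : ℕ) (G : Type*) [Group G] : Prop where
  prime : p.Prime
  odd : Odd p
  finite : Finite G
  isPGroup : IsPGroup p G
  isUCS : IsUCS G
  exponent_eq : Monoid.exponent G = p ^ 2

/-- The subgroup `N ^ n` generated by the `n`-th powers of the elements of `N`. -/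
def Subgroup.powersSubgroup {G : Type*} [Group G] (N : Subgroup G) (n : ℕ) : Subgroup G :=
  Subgroup.closure ((fun x => x ^ n) '' (N : Set G))

/-- A subgroup `N` of a `p`-group `G` is powerfully embedded in `G` if `[N, G] ≤ N ^ p` when
`p > 2`, and `[N, G] ≤ N ^ 4` when `p = 2`. -/
def Subgroup.IsPowerfullyEmbedded {G : Type*} [Group G] (p : ℕ) (N : Subgroup G) : Prop :=
  ⁅N, (⊤ : Subgroup G)⁆ ≤ N.powersSubgroup (if p = 2 then 4 else p)

/-- A not necessarily associative algebra `L` over `F` is simple if it is non-zero and its only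
(two-sided) ideals are `0` and `L`. -/
def IsSimpleNonassocAlgebra (F L : Type*) [CommRing F] [NonUnitalNonAssocRing L] [Module F L]
    [IsScalarTower F L L] [SMulCommClass F L L] : Prop :=
  Nontrivial L ∧
    ∀ I : Submodule F L, (∀ x ∈ I, ∀ y : L, x * y ∈ I ∧ y * x ∈ I) → I = ⊥ ∨ I = ⊤

namespace IsOddUCSExpSq

/-! ### The facts that make the algebra well defined -/

theorem nontrivial_group (p : ℕ) (G : Type*) [Group G]
    [hG : IsOddUCSExpSq p G] : Nontrivial G := by
  by_contra h
  rw [not_nontrivial_iff_subsingleton] at h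
  obtain ⟨N, ⟨_, h1, _⟩, _⟩ := hG.isUCS
  exact h1 (Subsingleton.elim _ _)

theorem eq_of_characteristic (p : ℕ) {G : Type*} [Group G]
    [hG : IsOddUCSExpSq p G] {A B : Subgroup G} (hA : A.Characteristic) (hA1 : A ≠ ⊥)
    (hA2 : A ≠ ⊤) (hB : B.Characteristic) (hB1 : B ≠ ⊥) (hB2 : B ≠ ⊤) : A = B :=
  hG.isUCS.unique ⟨hA, hA1, hA2⟩ ⟨hB, hB1, hB2⟩

theorem exists_pow_ne_one (p : ℕ) (G : Type*) [Group G]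
    [hG : IsOddUCSExpSq p G] : ∃ x : G, x ^ p ≠ 1 := by
  by_contra! h
  have h1 : Monoid.exponent G ∣ p := Monoid.exponent_dvd_of_forall_pow_eq_one h
  rw [hG.exponent_eq] at h1
  have h2 := Nat.le_of_dvd hG.prime.pos h1
  have h3 := hG.prime.two_le
  nlinarith

theorem maximal_facts (p : ℕ) {G : Type*} [Group G]
    [hG : IsOddUCSExpSq p G] (M : Subgroup G) (hM : IsCoatom M) :
    (∀ x : G, x ^ p ∈ M) ∧ ∀ x y : G, x⁻¹ * y⁻¹ * x * y ∈ M := by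
  have : Fact p.Prime := ⟨hG.prime⟩
  have := hG.finite
  have : Group.IsNilpotent G := hG.isPGroup.isNilpotent
  have hn : M.Normal :=
    Subgroup.NormalizerCondition.normal_of_coatom M Group.normalizerCondition_of_isNilpotent hM
  have hnt : Nontrivial (G ⧸ M) := QuotientGroup.nontrivial_iff.mpr hM.1
  have hp : IsPGroup p (G ⧸ M) := hG.isPGroup.to_quotient M
  have hs : IsSimpleGroup (G ⧸ M) := by
    refine ⟨fun K _ => ?_⟩
    have hle : M ≤ K.comap (QuotientGroup.mk' M) := by
      intro x hx
      have : QuotientGroup.mk' M x = 1 := (QuotientGroup.eq_one_iff x).mpr hx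
      rw [Subgroup.mem_comap, this]
      exact K.one_mem
    have hsurj := QuotientGroup.mk'_surjective M
    rcases hle.eq_or_lt with h | h
    · left
      rw [← Subgroup.map_comap_eq_self_of_surjective hsurj K, ← h,
        QuotientGroup.map_mk'_self]
    · right
      rw [← Subgroup.map_comap_eq_self_of_surjective hsurj K, hM.2 _ h,
        Subgroup.map_top_of_surjective _ hsurj]
  have hc : Subgroup.center (G ⧸ M) = ⊤ :=
    (IsSimpleGroup.eq_bot_or_eq_top_of_normal _ inferInstance).resolve_left hp.bot_lt_center.ne'
  have hcomm : ∀ a b : G ⧸ M, a * b = b * a := fun a b =>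
    (Subgroup.mem_center_iff.mp (hc ▸ Subgroup.mem_top b) a)
  let _ : CommGroup (G ⧸ M) := { (inferInstance : Group (G ⧸ M)) with mul_comm := hcomm }
  have hprime : (Nat.card (G ⧸ M)).Prime := IsSimpleGroup.prime_card
  obtain ⟨n, hn'⟩ := hp.exists_card_eq
  have hcard : Nat.card (G ⧸ M) = p := by
    rw [hn'] at hprime ⊢
    rw [Nat.Prime.eq_one_of_pow hprime, pow_one]
  constructor
  · intro x
    rw [← QuotientGroup.eq_one_iff, QuotientGroup.mk_pow, ← hcard]
    exact pow_card_eq_one'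
  · intro x y
    rw [← QuotientGroup.eq_one_iff, QuotientGroup.mk_mul, QuotientGroup.mk_mul,
      QuotientGroup.mk_mul, hcomm, QuotientGroup.mk_inv, QuotientGroup.mk_inv]
    rw [hcomm (x : G ⧸ M)⁻¹, inv_mul_cancel_right, mul_inv_cancel]

theorem pow_mem_frattini (p : ℕ) {G : Type*} [Group G]
    [hG : IsOddUCSExpSq p G] (x : G) : x ^ p ∈ frattini G := by
  simp only [frattini, Order.radical, Subgroup.mem_iInf]
  exact fun M hM => (maximal_facts p M hM).1 x

theorem comm_mem_frattini (p : ℕ) {G : Type*} [Group G]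
    [hG : IsOddUCSExpSq p G] (x y : G) : x⁻¹ * y⁻¹ * x * y ∈ frattini G := by
  simp only [frattini, Order.radical, Subgroup.mem_iInf]
  exact fun M hM => (maximal_facts p M hM).2 x y

theorem frattini_ne_bot (p : ℕ) (G : Type*) [Group G]
    [hG : IsOddUCSExpSq p G] : frattini G ≠ ⊥ := by
  intro h
  obtain ⟨x, hx⟩ := exists_pow_ne_one p G
  exact hx (by simpa [h] using pow_mem_frattini p x)

theorem frattini_ne_top (p : ℕ) (G : Type*) [Group G]
    [hG : IsOddUCSExpSq p G] : frattini G ≠ ⊤ := by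
  intro h
  have := hG.finite
  have := nontrivial_group p G
  exact bot_ne_top (frattini_nongenerating (K := (⊥ : Subgroup G)) (by simp [h]))

theorem frattini_le_center (p : ℕ) (G : Type*) [Group G]
    [hG : IsOddUCSExpSq p G] : frattini G ≤ Subgroup.center G := by
  have : Fact p.Prime := ⟨hG.prime⟩
  have := hG.finite
  have := nontrivial_group p G
  by_cases h : Subgroup.center G = ⊤
  · simp [h]
  · exact (eq_of_characteristic p inferInstance (frattini_ne_bot p G) (frattini_ne_top p G)
      inferInstance hG.isPGroup.bot_lt_center.ne' h).le

theorem pow_mul_of_central {G : Type*} [Group G] {x y z : G} (hz : z ∈ Subgroup.center G) (h : y * x = x * y * z)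
    (n : ℕ) : y ^ n * x = x * y ^ n * z ^ n := by
  have hz' : ∀ g : G, g * z = z * g := Subgroup.mem_center_iff.mp hz
  induction n with
  | zero => simp
  | succ n ih =>
    have hzn : Commute y (z ^ n) := (show Commute y z from hz' y).pow_right n
    calc y ^ (n + 1) * x = y ^ n * (y * x) := by rw [pow_succ, mul_assoc]
      _ = y ^ n * x * (y * z) := by rw [h]; simp only [mul_assoc]
      _ = x * y ^ n * (z ^ n * y) * z := by rw [ih]; simp only [mul_assoc]
      _ = x * (y ^ n * y) * (z ^ n * z) := by rw [← hzn.eq]; simp only [mul_assoc]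
      _ = x * y ^ (n + 1) * z ^ (n + 1) := by rw [← pow_succ, ← pow_succ]

theorem mul_pow_of_central {G : Type*} [Group G] {x y z : G} (hz : z ∈ Subgroup.center G) (h : y * x = x * y * z)
    (n : ℕ) : (x * y) ^ n = x ^ n * y ^ n * z ^ n.choose 2 := by
  have hz' : ∀ g : G, g * z = z * g := Subgroup.mem_center_iff.mp hz
  induction n with
  | zero => simp
  | succ n ih =>
    have h1 : Commute (x * y) (z ^ n.choose 2) :=
      (show Commute (x * y) z from hz' _).pow_right _
    have h2 : Commute y (z ^ n) := (show Commute y z from hz' y).pow_right n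
    calc (x * y) ^ (n + 1) = x ^ n * y ^ n * (z ^ n.choose 2 * (x * y)) := by
          rw [pow_succ, ih, mul_assoc]
      _ = x ^ n * (y ^ n * x) * y * z ^ n.choose 2 := by
          rw [← h1.eq]; simp only [mul_assoc]
      _ = x ^ n * x * y ^ n * (z ^ n * y) * z ^ n.choose 2 := by
          rw [pow_mul_of_central hz h]; simp only [mul_assoc]
      _ = x ^ n * x * (y ^ n * y) * (z ^ n * z ^ n.choose 2) := by
          rw [← h2.eq]; simp only [mul_assoc]
      _ = x ^ (n + 1) * y ^ (n + 1) * z ^ (n + 1).choose 2 := by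
          rw [← pow_succ, ← pow_succ, ← pow_add, Nat.choose_succ_succ' n 1, Nat.choose_one_right]

theorem mul_pow_p (p : ℕ) {G : Type*} [Group G]
    [hG : IsOddUCSExpSq p G] (x y : G) : (x * y) ^ p = x ^ p * y ^ p := by
  have hz : y⁻¹ * x⁻¹ * y * x ∈ Subgroup.center G :=
    frattini_le_center p G (comm_mem_frattini p y x)
  have h : y * x = x * y * (y⁻¹ * x⁻¹ * y * x) := by group
  have hy : x * y ^ p = y ^ p * x :=
    Subgroup.mem_center_iff.mp (frattini_le_center p G (pow_mem_frattini p y)) x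
  have hzp : (y⁻¹ * x⁻¹ * y * x) ^ p = 1 := by
    have := pow_mul_of_central hz h p
    rw [← hy] at this
    exact (left_eq_mul.mp this)
  obtain ⟨k, hk⟩ : p ∣ p.choose 2 := by
    refine hG.prime.dvd_choose_self two_ne_zero (lt_of_le_of_ne hG.prime.two_le ?_)
    rintro rfl
    exact absurd hG.odd (by decide)
  rw [mul_pow_of_central hz h, hk, pow_mul, hzp, one_pow, mul_one]

/-- The homomorphism `g ↦ g ^ p` from `G` to its Frattini subgroup. -/
def powHom (p : ℕ) (G : Type*) [Group G]
    [hG : IsOddUCSExpSq p G] : G →* frattini G where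
  toFun x := ⟨x ^ p, pow_mem_frattini p x⟩
  map_one' := by simp
  map_mul' x y := Subtype.ext (mul_pow_p p x y)

theorem ker_powHom (p : ℕ) (G : Type*) [Group G]
    [hG : IsOddUCSExpSq p G] : frattini G = (powHom p G).ker := by
  have := hG.finite
  have hmem : ∀ x : G, x ∈ (powHom p G).ker ↔ x ^ p = 1 := fun x => by
    simp [MonoidHom.mem_ker, powHom, Subtype.ext_iff]
  refine eq_of_characteristic p inferInstance (frattini_ne_bot p G) (frattini_ne_top p G) ?_ ?_ ?_
  · refine ⟨fun φ => ?_⟩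
    ext x
    rw [Subgroup.mem_comap, hmem, hmem]
    simp [← map_pow]
  · intro h
    have hinj : Function.Injective (powHom p G) := (MonoidHom.ker_eq_bot_iff _).mp h
    exact frattini_ne_top p G (Subgroup.eq_top_of_le_card _ (Nat.card_le_card_of_injective _ hinj))
  · intro h
    obtain ⟨x, hx⟩ := exists_pow_ne_one p G
    exact hx ((hmem x).mp (h ▸ Subgroup.mem_top x))

theorem powHom_surjective (p : ℕ) (G : Type*) [Group G]
    [hG : IsOddUCSExpSq p G] : Function.Surjective (powHom p G) := by
  let R : Subgroup G := (powHom p G).range.map (frattini G).subtype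
  have hmem : ∀ x : G, x ∈ R ↔ ∃ y : G, y ^ p = x := fun x => by
    simp [R, powHom]
  have hle : R ≤ frattini G := Subgroup.map_subtype_le _
  have hR : R = frattini G := by
    refine eq_of_characteristic p ?_ ?_ ?_ inferInstance (frattini_ne_bot p G)
      (frattini_ne_top p G)
    · refine ⟨fun φ => ?_⟩
      ext x
      rw [Subgroup.mem_comap, hmem, hmem]
      constructor
      · rintro ⟨y, hy⟩
        exact ⟨φ.symm y, by rw [← map_pow, hy]; simp⟩
      · rintro ⟨y, hy⟩
        exact ⟨φ y, by rw [← map_pow, hy]; simp⟩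
    · intro h
      obtain ⟨x, hx⟩ := exists_pow_ne_one p G
      have : x ^ p ∈ R := (hmem _).mpr ⟨x, rfl⟩
      exact hx (by simpa [h] using this)
    · intro h
      exact frattini_ne_top p G (top_le_iff.mp (h ▸ hle))
  rintro ⟨x, hx⟩
  obtain ⟨y, hy⟩ := (hmem x).mp (hR ▸ hx)
  exact ⟨y, Subtype.ext hy⟩

/-- The isomorphism `G / Φ(G) ≃ Φ(G)` sending the class of `g` to `g ^ p`. Its inverse is the map
written `h ↦ h ^ (1 / p)`. -/
noncomputable def powEquiv (p : ℕ) (G : Type*) [Group G]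
    [hG : IsOddUCSExpSq p G] : G ⧸ frattini G ≃* frattini G :=
  QuotientGroup.liftEquiv (frattini G) (powHom_surjective p G) (ker_powHom p G)

theorem coe_powEquiv_mk (p : ℕ) (G : Type*) [Group G]
    [hG : IsOddUCSExpSq p G] (g : G) : (powEquiv p G (g : G ⧸ frattini G) : G) = g ^ p := rfl

theorem comm_congr (p : ℕ) (G : Type*) [Group G]
    [hG : IsOddUCSExpSq p G] (x y a b : G) (ha : a ∈ frattini G) (hb : b ∈ frattini G) :
    (x * a)⁻¹ * (y * b)⁻¹ * (x * a) * (y * b) = x⁻¹ * y⁻¹ * x * y := by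
  have ha' : ∀ g : G, g * a = a * g := Subgroup.mem_center_iff.mp (frattini_le_center p G ha)
  have hb' : ∀ g : G, g * b = b * g := Subgroup.mem_center_iff.mp (frattini_le_center p G hb)
  have hb'' : ∀ g : G, g * b⁻¹ = b⁻¹ * g :=
    Subgroup.mem_center_iff.mp (inv_mem (frattini_le_center p G hb))
  calc (x * a)⁻¹ * (y * b)⁻¹ * (x * a) * (y * b)
      = (x * a)⁻¹ * (b⁻¹ * y⁻¹) * (x * a) * (b * y) := by rw [mul_inv_rev y, hb' y]
    _ = b⁻¹ * ((x * a)⁻¹ * y⁻¹ * (x * a) * b) * y := by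
        rw [← mul_assoc (x * a)⁻¹, hb'']; simp only [mul_assoc]
    _ = b⁻¹ * (b * ((x * a)⁻¹ * y⁻¹ * (x * a))) * y := by rw [hb']
    _ = (x * a)⁻¹ * (y⁻¹ * x * a) * y := by rw [inv_mul_cancel_left]; simp only [mul_assoc]
    _ = (a * x)⁻¹ * (a * (y⁻¹ * x)) * y := by rw [ha' x, ha' (y⁻¹ * x)]
    _ = x⁻¹ * y⁻¹ * x * y := by group

/-- The commutator map `(x Φ(G), y Φ(G)) ↦ [x, y] = x⁻¹ y⁻¹ x y` with values in `Φ(G)`. -/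
def commMap (p : ℕ) (G : Type*) [Group G]
    [hG : IsOddUCSExpSq p G] (u v : G ⧸ frattini G) : frattini G :=
  Quotient.liftOn₂ u v (fun x y => ⟨x⁻¹ * y⁻¹ * x * y, comm_mem_frattini p x y⟩) (by
    intro x₁ y₁ x₂ y₂ hx hy
    have hx' := QuotientGroup.leftRel_apply.mp hx
    have hy' := QuotientGroup.leftRel_apply.mp hy
    apply Subtype.ext
    have := comm_congr p G x₁ y₁ _ _ hx' hy'
    simpa using this.symm)

theorem coe_commMap_mk (p : ℕ) (G : Type*) [Group G]
    [hG : IsOddUCSExpSq p G] (x y : G) :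
    (commMap p G (x : G ⧸ frattini G) (y : G ⧸ frattini G) : G) = x⁻¹ * y⁻¹ * x * y := rfl

theorem commMap_mul_left (p : ℕ) (G : Type*) [Group G]
    [hG : IsOddUCSExpSq p G] (u v w : G ⧸ frattini G) :
    commMap p G (u * v) w = commMap p G u w * commMap p G v w := by
  induction u using QuotientGroup.induction_on with | H x => ?_
  induction v using QuotientGroup.induction_on with | H y => ?_
  induction w using QuotientGroup.induction_on with | H z => ?_
  apply Subtype.ext
  rw [← QuotientGroup.mk_mul, Subgroup.coe_mul, coe_commMap_mk, coe_commMap_mk, coe_commMap_mk]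
  have h : y * (x⁻¹ * z⁻¹ * x * z) = (x⁻¹ * z⁻¹ * x * z) * y :=
    Subgroup.mem_center_iff.mp (frattini_le_center p G (comm_mem_frattini p x z)) y
  calc (x * y)⁻¹ * z⁻¹ * (x * y) * z
      = y⁻¹ * ((x⁻¹ * z⁻¹ * x * z) * (z⁻¹ * y * z)) := by group
    _ = (x⁻¹ * z⁻¹ * x * z) * y * (y⁻¹ * y⁻¹) * (z⁻¹ * y * z) := by
        have h2 : y⁻¹ * (x⁻¹ * z⁻¹ * x * z) = (x⁻¹ * z⁻¹ * x * z) * y⁻¹ :=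
          Subgroup.mem_center_iff.mp (frattini_le_center p G (comm_mem_frattini p x z)) y⁻¹
        rw [← mul_assoc, h2]; group
    _ = x⁻¹ * z⁻¹ * x * z * (y⁻¹ * z⁻¹ * y * z) := by group

theorem commMap_mul_right (p : ℕ) (G : Type*) [Group G]
    [hG : IsOddUCSExpSq p G] (u v w : G ⧸ frattini G) :
    commMap p G u (v * w) = commMap p G u v * commMap p G u w := by
  have hinv : ∀ a b : G ⧸ frattini G, commMap p G a b = (commMap p G b a)⁻¹ := by
    intro a b
    induction a using QuotientGroup.induction_on with | H x => ?_
    induction b using QuotientGroup.induction_on with | H y => ?_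
    apply Subtype.ext
    rw [Subgroup.coe_inv, coe_commMap_mk, coe_commMap_mk]
    group
  have hc : ∀ a b : frattini G, a * b = b * a := fun a b =>
    Subtype.ext (Subgroup.mem_center_iff.mp (frattini_le_center p G b.2) a)
  rw [hinv u, commMap_mul_left, mul_inv_rev, ← hinv, ← hinv, hc]

end IsOddUCSExpSq

/-! ### The algebra `L(G)` -/

/-- The underlying set `G / Φ(G)` of the algebra `L(G)`, written additively. -/
def UCSAlgebra (_p : ℕ) (G : Type*) [Group G] : Type _ := Additive (G ⧸ frattini G)

namespace UCSAlgebra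

open IsOddUCSExpSq

/-- The class `g Φ(G)` of `g`, as an element of `L(G)`. -/
def mk (p : ℕ) {G : Type*} [Group G] (g : G) : UCSAlgebra p G :=
  Additive.ofMul (g : G ⧸ frattini G)

variable (p : ℕ) (G : Type*) [Group G] [hG : IsOddUCSExpSq p G]

/-- The addition of `L(G)` is the group operation of `G / Φ(G)`. -/
instance : AddCommGroup (UCSAlgebra p G) :=
  letI : CommGroup (G ⧸ frattini G) :=
    { (inferInstance : Group (G ⧸ frattini G)) with
      mul_comm := fun u v => by
        induction u using QuotientGroup.induction_on with | H x => ?_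
        induction v using QuotientGroup.induction_on with | H y => ?_
        rw [← QuotientGroup.mk_mul, ← QuotientGroup.mk_mul, QuotientGroup.eq]
        have := comm_mem_frattini p y x
        simpa [mul_assoc] using this }
  inferInstanceAs (AddCommGroup (Additive (G ⧸ frattini G)))

/-- The product of `L(G)`: the product of the classes of `x` and `y` is `[x, y] ^ (1 / p)`. -/
noncomputable instance : NonUnitalNonAssocRing (UCSAlgebra p G) :=
  { (inferInstance : AddCommGroup (UCSAlgebra p G)) with
    mul := fun u v => Additive.ofMul ((powEquiv p G).symm (commMap p G u.toMul v.toMul))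
    left_distrib := fun u v w =>
      (congrArg (fun t => Additive.ofMul ((powEquiv p G).symm t))
        (commMap_mul_right p G u.toMul v.toMul w.toMul)).trans
        (congrArg Additive.ofMul (map_mul (powEquiv p G).symm _ _))
    right_distrib := fun u v w =>
      (congrArg (fun t => Additive.ofMul ((powEquiv p G).symm t))
        (commMap_mul_left p G u.toMul v.toMul w.toMul)).trans
        (congrArg Additive.ofMul (map_mul (powEquiv p G).symm _ _))
    zero_mul := fun v => by
      have h : commMap p G 1 v.toMul = 1 := by
        have := commMap_mul_left p G 1 1 v.toMul
        rwa [one_mul, left_eq_mul] at this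
      exact congrArg Additive.ofMul
        ((congrArg (powEquiv p G).symm h).trans (map_one (powEquiv p G).symm))
    mul_zero := fun v => by
      have h : commMap p G v.toMul 1 = 1 := by
        have := commMap_mul_right p G v.toMul 1 1
        rwa [one_mul, left_eq_mul] at this
      exact congrArg Additive.ofMul
        ((congrArg (powEquiv p G).symm h).trans (map_one (powEquiv p G).symm)) }

/-- The `ZMod p`-vector space structure of `L(G)`, for which `n • (g Φ(G)) = g ^ n Φ(G)`. -/
instance : Module (ZMod p) (UCSAlgebra p G) :=
  AddCommGroup.zmodModule (n := p) (fun u => by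
    obtain ⟨g, hg⟩ := QuotientGroup.mk_surjective u.toMul
    have h : (g : G ⧸ frattini G) ^ p = 1 := by
      rw [← QuotientGroup.mk_pow, QuotientGroup.eq_one_iff]
      exact pow_mem_frattini p g
    rw [hg] at h
    exact congrArg Additive.ofMul h)

instance : IsScalarTower (ZMod p) (UCSAlgebra p G) (UCSAlgebra p G) :=
  ⟨fun c u v => ZMod.map_smul (AddMonoidHom.mulRight v) c u⟩

instance : SMulCommClass (ZMod p) (UCSAlgebra p G) (UCSAlgebra p G) :=
  ⟨fun c u v => (ZMod.map_smul (AddMonoidHom.mulLeft u) c v).symm⟩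

variable {G}

theorem mk_add_mk (x y : G) : mk p x + mk p y = mk p (x * y) := rfl

theorem natCast_smul_mk (n : ℕ) (x : G) : (n : ZMod p) • mk p x = mk p (x ^ n) :=
  (Nat.cast_smul_eq_nsmul (ZMod p) n (mk p x)).trans rfl

/-- The product of the classes of `x` and `y` is the class of `z` exactly when `z ^ p = [x, y]`. -/
theorem mk_mul_mk_eq_iff (x y z : G) :
    mk p x * mk p y = mk p z ↔ z ^ p = x⁻¹ * y⁻¹ * x * y := by
  have h : mk p x * mk p y = mk p z ↔
      (powEquiv p G).symm (commMap p G (x : G ⧸ frattini G) (y : G ⧸ frattini G)) =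
        (z : G ⧸ frattini G) := Iff.rfl
  rw [h, MulEquiv.symm_apply_eq, Subtype.ext_iff, coe_powEquiv_mk, coe_commMap_mk]
  exact eq_comm

end UCSAlgebra

/-! The map `g ↦ g ^ p` is an endomorphism of `G` with kernel and image `Φ(G)`. Subspaces of `L(G)`
are therefore subgroups `N ≥ Φ(G)`, and such a subspace is an ideal exactly when each `[x, y]` with
`x ∈ N` is a `p`-th power from `N`. This is (b) ⇔ (c), `UCSAlgebra.isSimple_iff`. In a direct power,
one factor times `Φ(G)` is such an `N`, so (b) implies (a).

For (a) implies (b), take a subgroup `M` that corresponds to a minimal ideal. Distinct images of `M`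
under automorphisms meet in `Φ(G)`, hence commute, and together they generate `G` because `G` is
UCS. They all contain `Φ(G)`, so their product is not direct; `M` is first cut down to `H` with `H
Φ(G) = M` and `H ∩ Φ(G) = M ^ p = H ^ p` (`exists_isPowerComplement`). One copy of `H` for each
image of `M` then gives a direct decomposition (`bijective_noncommPiCoprod`), with at least two
factors since `M` is proper. Finally `H` is UCS: a characteristic subgroup of `H` is compared with a
characteristic subgroup of `G` through the projection `G → H` (`IsPowerComplement.isUCS`). -/

/-! ### Roots of Frattini elements and powerful embedding -/

namespace IsOddUCSExpSq

variable (p : ℕ) {G : Type*} [Group G] [hG : IsOddUCSExpSq p G]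

theorem pow_eq_one_iff_mem_frattini (x : G) : x ^ p = 1 ↔ x ∈ frattini G := by
  rw [ker_powHom p G, MonoidHom.mem_ker, Subtype.ext_iff]
  rfl

theorem exists_pow_eq_of_mem_frattini {x : G} (hx : x ∈ frattini G) : ∃ y : G, y ^ p = x := by
  obtain ⟨y, hy⟩ := powHom_surjective p G ⟨x, hx⟩
  exact ⟨y, congrArg Subtype.val hy⟩

theorem inv_mul_mem_frattini_of_pow_eq {x y : G} (h : x ^ p = y ^ p) :
    x⁻¹ * y ∈ frattini G := by
  rw [← pow_eq_one_iff_mem_frattini p, mul_pow_p p, inv_pow, h, inv_mul_cancel]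

theorem mem_powersSubgroup_iff (N : Subgroup G) (x : G) :
    x ∈ N.powersSubgroup p ↔ ∃ y ∈ N, y ^ p = x := by
  constructor
  · intro hx
    refine Subgroup.closure_induction (p := fun x _ => ∃ y ∈ N, y ^ p = x) ?_ ?_ ?_ ?_ hx
    · rintro _ ⟨y, hy, rfl⟩
      exact ⟨y, hy, rfl⟩
    · exact ⟨1, N.one_mem, one_pow p⟩
    · rintro _ _ _ _ ⟨y, hy, rfl⟩ ⟨z, hz, rfl⟩
      exact ⟨y * z, N.mul_mem hy hz, mul_pow_p p y z⟩
    · rintro _ _ ⟨y, hy, rfl⟩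
      exact ⟨y⁻¹, N.inv_mem hy, inv_pow y p⟩
  · rintro ⟨y, hy, rfl⟩
    exact Subgroup.subset_closure ⟨y, hy, rfl⟩

theorem isPowerfullyEmbedded_iff (N : Subgroup G) :
    N.IsPowerfullyEmbedded p ↔ ∀ x ∈ N, ∀ y : G, ∃ z ∈ N, z ^ p = x⁻¹ * y⁻¹ * x * y := by
  have hp : p ≠ 2 := by
    rintro rfl
    exact absurd hG.odd (by decide)
  rw [Subgroup.IsPowerfullyEmbedded, if_neg hp, Subgroup.commutator_le]
  simp only [mem_powersSubgroup_iff]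
  constructor
  · intro h x hx y
    -- `⁅x, y⁆` is `x * y * x⁻¹ * y⁻¹`, so both arguments are inverted to pass to `x⁻¹ * y⁻¹ * x *
    -- y`.
    simpa [commutatorElement_def] using h x⁻¹ (N.inv_mem hx) y⁻¹ trivial
  · intro h x hx y _
    simpa [commutatorElement_def] using h x⁻¹ (N.inv_mem hx) y⁻¹

theorem center_eq_frattini (p : ℕ) {G : Type*} [Group G] [hG : IsOddUCSExpSq p G]
    (hna : ¬ ∀ x y : G, x * y = y * x) :
    Subgroup.center G = frattini G := by
  refine eq_of_characteristic p inferInstance ?_ ?_ inferInstance (frattini_ne_bot p G)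
    (frattini_ne_top p G)
  · intro h
    exact frattini_ne_bot p G (le_bot_iff.mp (h ▸ frattini_le_center p G))
  · intro h
    exact hna fun x y =>
      Subgroup.mem_center_iff.mp (h ▸ Subgroup.mem_top y : y ∈ Subgroup.center G) x

theorem eq_top_of_characteristic (p : ℕ) {G : Type*} [Group G] [hG : IsOddUCSExpSq p G]
    {M : Subgroup G} (hM : M.Characteristic)
    (h : ¬ M ≤ frattini G) : M = ⊤ := by
  by_contra hT
  have hB : M ≠ ⊥ := fun hB => h (hB ▸ bot_le)
  exact h (eq_of_characteristic p hM hB hT inferInstance (frattini_ne_bot p G)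
    (frattini_ne_top p G)).le

end IsOddUCSExpSq

/-! ### Ideals of `L(G)` as subgroups above `Φ(G)` -/

namespace UCSAlgebra

open IsOddUCSExpSq

theorem mk_surjective (p : ℕ) {G : Type*} [Group G] :
    Function.Surjective (mk p : G → UCSAlgebra p G) := fun u =>
  QuotientGroup.mk_surjective u.toMul

theorem mk_eq_mk_iff (p : ℕ) {G : Type*} [Group G] (x y : G) :
    mk p x = mk p y ↔ x⁻¹ * y ∈ frattini G :=
  QuotientGroup.eq

variable (p : ℕ) {G : Type*} [Group G] [hG : IsOddUCSExpSq p G]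

theorem mk_eq_zero_iff (x : G) : mk p x = 0 ↔ x ∈ frattini G :=
  QuotientGroup.eq_one_iff x

theorem mk_one : mk p (1 : G) = 0 := (mk_eq_zero_iff p 1).mpr (one_mem _)

theorem mk_inv (x : G) : mk p x⁻¹ = -mk p x := rfl

theorem mk_mul (x y : G) : mk p (x * y) = mk p x + mk p y := rfl

/-- The subspace of `L(G)` of the classes of the elements of a subgroup. -/
def ofSubgroup (N : Subgroup G) : Submodule (ZMod p) (UCSAlgebra p G) :=
  AddSubgroup.toZModSubmodule p
    { carrier := mk p '' (N : Set G)
      zero_mem' := ⟨1, N.one_mem, mk_one p⟩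
      add_mem' := by
        rintro _ _ ⟨x, hx, rfl⟩ ⟨y, hy, rfl⟩
        exact ⟨x * y, N.mul_mem hx hy, mk_mul p x y⟩
      neg_mem' := by
        rintro _ ⟨x, hx, rfl⟩
        exact ⟨x⁻¹, N.inv_mem hx, mk_inv p x⟩ }

theorem mk_mem_ofSubgroup_iff {N : Subgroup G} (hN : frattini G ≤ N) (x : G) :
    mk p x ∈ ofSubgroup p N ↔ x ∈ N := by
  refine ⟨?_, fun hx => ⟨x, hx, rfl⟩⟩
  rintro ⟨y, hy, h⟩
  have := N.mul_mem hy (hN ((mk_eq_mk_iff p y x).mp h))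
  rwa [mul_inv_cancel_left] at this

/-- The subgroup of the elements of `G` whose classes lie in a subspace of `L(G)`. -/
def toSubgroup (I : Submodule (ZMod p) (UCSAlgebra p G)) : Subgroup G where
  carrier := {x | mk p x ∈ I}
  one_mem' := by
    change mk p 1 ∈ I
    rw [mk_one]
    exact I.zero_mem
  mul_mem' hx hy := I.add_mem hx hy
  inv_mem' hx := I.neg_mem hx

theorem mem_toSubgroup (I : Submodule (ZMod p) (UCSAlgebra p G)) (x : G) :
    x ∈ toSubgroup p I ↔ mk p x ∈ I := Iff.rfl

theorem frattini_le_toSubgroup (I : Submodule (ZMod p) (UCSAlgebra p G)) :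
    frattini G ≤ toSubgroup p I := fun x hx => by
  rw [mem_toSubgroup, (mk_eq_zero_iff p x).mpr hx]
  exact I.zero_mem

theorem exists_mk_mul_mk (x y : G) : ∃ z : G, z ^ p = x⁻¹ * y⁻¹ * x * y ∧
    mk p x * mk p y = mk p z := by
  obtain ⟨z, hz⟩ := mk_surjective p (mk p x * mk p y)
  exact ⟨z, (mk_mul_mk_eq_iff p x y z).mp hz.symm, hz.symm⟩

/-- `ofSubgroup` and `toSubgroup` match ideals with powerfully embedded subgroups. One-sided closure
suffices because `[y, x] = [x, y]⁻¹`. -/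
theorem isSimple_iff :
    IsSimpleNonassocAlgebra (ZMod p) (UCSAlgebra p G) ↔
      ¬ ∃ N : Subgroup G, N.IsPowerfullyEmbedded p ∧ N ≠ ⊤ ∧ frattini G < N := by
  constructor
  · rintro ⟨-, h⟩ ⟨N, hpe, htop, hlt⟩
    rw [isPowerfullyEmbedded_iff] at hpe
    have key : ∀ x : G, mk p x ∈ ofSubgroup p N ↔ x ∈ N := mk_mem_ofSubgroup_iff p hlt.le
    have hI : ∀ u ∈ ofSubgroup p N, ∀ v, u * v ∈ ofSubgroup p N ∧ v * u ∈ ofSubgroup p N := by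
      intro u hu v
      obtain ⟨x, rfl⟩ := mk_surjective p u
      obtain ⟨y, rfl⟩ := mk_surjective p v
      obtain ⟨z, hz, hz'⟩ := hpe x ((key x).mp hu) y
      rw [(mk_mul_mk_eq_iff p x y z).mpr hz', (mk_mul_mk_eq_iff p y x z⁻¹).mpr, key, key]
      · exact ⟨hz, N.inv_mem hz⟩
      · rw [inv_pow, hz']
        group
    rcases h (ofSubgroup p N) hI with h0 | h1
    · refine hlt.not_ge fun x hx => ?_
      rw [← key, h0, Submodule.mem_bot] at hx
      exact (mk_eq_zero_iff p x).mp hx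
    · refine htop (eq_top_iff.mpr fun x _ => ?_)
      rw [← key, h1]
      exact Submodule.mem_top
  · intro h
    constructor
    · obtain ⟨x, hx⟩ := exists_pow_ne_one p G
      refine ⟨mk p x, 0, fun h0 => hx ?_⟩
      rwa [pow_eq_one_iff_mem_frattini p, ← mk_eq_zero_iff p]
    · intro I hI
      by_contra! hc
      refine h ⟨toSubgroup p I, ?_, ?_, ?_⟩
      · rw [isPowerfullyEmbedded_iff]
        intro x hx y
        obtain ⟨z, hz, hz'⟩ := exists_mk_mul_mk p x y
        refine ⟨z, ?_, hz⟩
        rw [mem_toSubgroup, ← hz']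
        exact (hI _ hx _).1
      · intro ht
        refine hc.2 (eq_top_iff.mpr fun u _ => ?_)
        obtain ⟨x, rfl⟩ := mk_surjective p u
        rw [← mem_toSubgroup, ht]
        trivial
      · refine lt_of_le_not_ge (frattini_le_toSubgroup p I) fun hle => hc.1 ?_
        refine eq_bot_iff.mpr fun u hu => ?_
        obtain ⟨x, rfl⟩ := mk_surjective p u
        rw [Submodule.mem_bot, mk_eq_zero_iff]
        exact hle hu

end UCSAlgebra

/-! ### A factor of a direct power is powerfully embedded modulo `Φ(G)` -/

namespace IsOddUCSExpSq

theorem exists_isPowerfullyEmbedded_of_mulEquiv (p : ℕ) {G : Type*} [Group G]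
    [hG : IsOddUCSExpSq p G] (hna : ¬ ∀ x y : G, x * y = y * x) {ι H : Type*} [DecidableEq ι]
    [Group H] (e : G ≃* (ι → H)) {i j : ι} (hij : i ≠ j) :
    ∃ N : Subgroup G, N.IsPowerfullyEmbedded p ∧ N ≠ ⊤ ∧ frattini G < N := by
  have := hG.finite
  have hH : ∃ a b : H, a * b ≠ b * a := by
    by_contra! hc
    exact hna fun x y => e.injective (by rw [map_mul, map_mul]; exact funext fun _ => hc _ _)
  obtain ⟨a, b, hab⟩ := hH
  let M : Subgroup G := (MonoidHom.mulSingle (fun _ : ι => H) i).range.comap e.toMonoidHom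
  have hM : ∀ x, x ∈ M ↔ ∃ h : H, Pi.mulSingle i h = e x := fun x => Iff.rfl
  have hsymm : ∀ h : H, e.symm (Pi.mulSingle i h) ∈ M := fun h => (hM _).mpr ⟨h, by simp⟩
  have hcentral := frattini_le_center p G
  refine ⟨M ⊔ frattini G, ?_, ?_, ?_⟩
  · rw [isPowerfullyEmbedded_iff]
    intro x hx y
    obtain ⟨m, hm, d, hd, rfl⟩ := Subgroup.mem_sup_of_normal_right.mp hx
    obtain ⟨h, hh⟩ := (hM m).mp hm
    have hcomm : (m * d)⁻¹ * y⁻¹ * (m * d) * y = m⁻¹ * y⁻¹ * m * y := by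
      simpa using comm_congr p G m y d 1 hd (one_mem _)
    obtain ⟨z, hz⟩ := exists_pow_eq_of_mem_frattini p (comm_mem_frattini p m y)
    -- Since `m` lives in the factor `i`, so does `[m, y] = z ^ p`; the root `z` may be replaced by
    -- its `i`-th coordinate.
    refine ⟨e.symm (Pi.mulSingle i (e z i)), Subgroup.mem_sup_left (hsymm _), ?_⟩
    rw [hcomm, ← hz]
    apply e.injective
    rw [map_pow, map_pow, e.apply_symm_apply]
    funext l
    by_cases hl : l = i
    · subst hl
      simp
    · have h1 := congrFun (congrArg e hz) l
      simp only [map_mul, map_pow, map_inv, Pi.mul_apply, Pi.pow_apply, Pi.inv_apply, ← hh,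
        Pi.mulSingle_eq_of_ne hl] at h1
      simp [Pi.mulSingle_eq_of_ne hl, h1]
  · intro h
    have h1 : M = ⊤ := frattini_nongenerating h
    have h2 : e.symm (Pi.mulSingle j a) ∈ M := h1 ▸ Subgroup.mem_top _
    obtain ⟨c, hc⟩ := (hM _).mp h2
    have h3 := congrFun hc j
    rw [e.apply_symm_apply, Pi.mulSingle_eq_same, Pi.mulSingle_eq_of_ne hij.symm] at h3
    rw [← h3] at hab
    simp at hab
  · refine lt_of_le_not_ge le_sup_right fun hle => hab ?_
    have h1 := Subgroup.mem_center_iff.mp (hcentral (hle (Subgroup.mem_sup_left (hsymm b))))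
      (e.symm (Pi.mulSingle i a))
    have h2 := congrFun (congrArg e h1) i
    simpa using h2

end IsOddUCSExpSq

/-! ### Minimal embedded subgroups and complements modulo `p`-th powers -/

namespace IsOddUCSExpSq

/-- The least subgroups that properly contain the Frattini subgroup and are powerfully embedded;
the last condition is spelled out with `p`-th powers. -/
structure IsMinimalEmbedded (p : ℕ) {G : Type*} [Group G] (N : Subgroup G) : Prop where
  lt : frattini G < N
  embedded : ∀ x ∈ N, ∀ y : G, ∃ z ∈ N, z ^ p = x⁻¹ * y⁻¹ * x * y
  eq_of_le : ∀ M : Subgroup G, frattini G < M → M ≤ N →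
    (∀ x ∈ M, ∀ y : G, ∃ z ∈ M, z ^ p = x⁻¹ * y⁻¹ * x * y) → M = N

theorem exists_isMinimalEmbedded (p : ℕ) {G : Type*} [Group G] [Finite G] {N : Subgroup G}
    (hlt : frattini G < N) (hN : ∀ x ∈ N, ∀ y : G, ∃ z ∈ N, z ^ p = x⁻¹ * y⁻¹ * x * y) :
    ∃ M ≤ N, IsMinimalEmbedded p M := by
  obtain ⟨M, hMN, hM⟩ := Finite.exists_le_minimal (α := Subgroup G)
    (p := fun M : Subgroup G => frattini G < M ∧
      ∀ x ∈ M, ∀ y : G, ∃ z ∈ M, z ^ p = x⁻¹ * y⁻¹ * x * y) ⟨hlt, hN⟩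
  exact ⟨M, hMN, hM.prop.1, hM.prop.2, fun K h1 h2 h3 => (hM.eq_of_le ⟨h1, h3⟩ h2)⟩

theorem apply_mem_frattini {G : Type*} [Group G] (φ : G ≃* G) {x : G} (hx : x ∈ frattini G) :
    φ x ∈ frattini G := by
  have h := (inferInstance : (frattini G).Characteristic).fixed φ
  rw [← h] at hx
  exact hx

/-- Two `p`-th roots of one element differ by an element of `Φ(G)`, so a commutator that has roots
in `N` and in `M` has one in `N ⊓ M`. By minimality `N ⊓ M = Φ(G)`, where `p`-th powers are trivial.
-/
theorem IsMinimalEmbedded.commute {p : ℕ} {G : Type*} [Group G] [hG : IsOddUCSExpSq p G]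
    {N M : Subgroup G} (hN : IsMinimalEmbedded p N) (hM : IsMinimalEmbedded p M) (hne : N ≠ M)
    {x y : G} (hx : x ∈ N) (hy : y ∈ M) : Commute x y := by
  have key : ∀ x ∈ N, ∀ y : G, x⁻¹ * y⁻¹ * x * y ∈ M.powersSubgroup p →
      ∃ z ∈ N ⊓ M, z ^ p = x⁻¹ * y⁻¹ * x * y := by
    intro x hx y hxy
    obtain ⟨z, hz, hz'⟩ := hN.embedded x hx y
    obtain ⟨w, hw, hw'⟩ := (mem_powersSubgroup_iff p M _).mp hxy
    refine ⟨z, ⟨hz, ?_⟩, hz'⟩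
    have := M.mul_mem hw (hM.lt.le (inv_mul_mem_frattini_of_pow_eq p (hw'.trans hz'.symm)))
    rwa [mul_inv_cancel_left] at this
  have hinf : N ⊓ M = frattini G := by
    by_contra hc
    have hlt : frattini G < N ⊓ M := lt_of_le_of_ne (le_inf hN.lt.le hM.lt.le) (Ne.symm hc)
    have hemb : ∀ x ∈ N ⊓ M, ∀ y : G, ∃ z ∈ N ⊓ M, z ^ p = x⁻¹ * y⁻¹ * x * y := fun x hx y =>
      key x hx.1 y ((mem_powersSubgroup_iff p M _).mpr (hM.embedded x hx.2 y))
    exact hne ((hN.eq_of_le _ hlt inf_le_left hemb).symm.trans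
      (hM.eq_of_le _ hlt inf_le_right hemb))
  obtain ⟨z, hz, hz'⟩ := key x hx y ((mem_powersSubgroup_iff p M _).mpr (by
    obtain ⟨w, hw, hw'⟩ := hM.embedded y hy x
    refine ⟨w⁻¹, M.inv_mem hw, ?_⟩
    rw [inv_pow, hw']
    group))
  rw [hinf, ← pow_eq_one_iff_mem_frattini p, hz'] at hz
  have h : x * y = y * x * (x⁻¹ * y⁻¹ * x * y) := by group
  rw [hz, mul_one] at h
  exact h

theorem IsMinimalEmbedded.map {p : ℕ} {G : Type*} [Group G]
    {N : Subgroup G} (hN : IsMinimalEmbedded p N) (φ : G ≃* G) :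
    IsMinimalEmbedded p (N.map φ.toMonoidHom) := by
  have hcomap : ∀ (M : Subgroup G) (ψ : G ≃* G), frattini G < M →
      frattini G < M.map ψ.toMonoidHom := by
    intro M ψ hM
    refine lt_of_le_not_ge (fun x hx => ⟨ψ.symm x, hM.le (apply_mem_frattini _ hx), by simp⟩) ?_
    intro hle
    refine hM.not_ge fun x hx => ?_
    simpa using apply_mem_frattini ψ.symm (hle (⟨x, hx, rfl⟩ : ψ x ∈ M.map ψ.toMonoidHom))
  have hemb : ∀ (M : Subgroup G) (ψ : G ≃* G),
      (∀ x ∈ M, ∀ y : G, ∃ z ∈ M, z ^ p = x⁻¹ * y⁻¹ * x * y) →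
      ∀ x ∈ M.map ψ.toMonoidHom, ∀ y : G, ∃ z ∈ M.map ψ.toMonoidHom,
        z ^ p = x⁻¹ * y⁻¹ * x * y := by
    rintro M ψ hM _ ⟨x, hx, rfl⟩ y
    obtain ⟨z, hz, hz'⟩ := hM x hx (ψ.symm y)
    refine ⟨ψ z, ⟨z, hz, rfl⟩, ?_⟩
    rw [← map_pow, hz']
    simp
  refine ⟨hcomap N φ hN.lt, hemb N φ hN.embedded, fun M h1 h2 h3 => ?_⟩
  have h := hN.eq_of_le (M.map φ.symm.toMonoidHom) (hcomap M _ h1) ?_ (hemb M _ h3)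
  · rw [← h, Subgroup.map_map]
    ext x
    simp
  · rintro _ ⟨x, hx, rfl⟩
    obtain ⟨y, hy, rfl⟩ := h2 hx
    simpa using hy

/-- The join of all automorphic images is characteristic. -/
theorem iSup_map_mulEquiv_eq_top (p : ℕ) {G : Type*} [Group G] [hG : IsOddUCSExpSq p G]
    {N : Subgroup G} (hN : ¬ N ≤ frattini G) : ⨆ φ : G ≃* G, N.map φ.toMonoidHom = ⊤ := by
  refine eq_top_of_characteristic p ?_ fun h => hN ?_
  · rw [Subgroup.characteristic_iff_map_le]
    intro ψ
    rw [Subgroup.map_iSup]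
    refine iSup_le fun φ => ?_
    rw [Subgroup.map_map]
    exact le_iSup (fun φ : G ≃* G => N.map φ.toMonoidHom) (φ.trans ψ)
  · refine le_trans ?_ ((le_iSup (fun φ : G ≃* G => N.map φ.toMonoidHom) (MulEquiv.refl G)).trans h)
    intro x hx
    exact ⟨x, hx, rfl⟩

/-- A subgroup `H` of `N` that complements the Frattini subgroup modulo the `p`-th powers of `N`. -/
structure IsPowerComplement (p : ℕ) {G : Type*} [Group G] (N H : Subgroup G) : Prop where
  le : H ≤ N
  pow_mem : ∀ x ∈ N, x ^ p ∈ H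
  exists_pow_eq : ∀ x ∈ H, x ∈ frattini G → ∃ y ∈ N, y ^ p = x
  exists_mul_eq : ∀ x ∈ N, ∃ h ∈ H, ∃ d ∈ frattini G, h * d = x

/-- Since `[N, N] ≤ N ^ p`, the quotient `N / N ^ p` is elementary abelian and the image of `N ∩
Φ(G)` has a complement in it; `H` is the preimage, found as a maximal subgroup between `N ^ p` and
`N` meeting `Φ(G)` inside `N ^ p`. -/
theorem exists_isPowerComplement (p : ℕ) {G : Type*} [Group G] [hG : IsOddUCSExpSq p G]
    {N : Subgroup G} (hN : ∀ x ∈ N, ∀ y : G, ∃ z ∈ N, z ^ p = x⁻¹ * y⁻¹ * x * y) :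
    ∃ H, IsPowerComplement p N H := by
  have := hG.finite
  obtain ⟨H, -, hH⟩ := Finite.exists_le_maximal (α := Subgroup G)
    (p := fun H : Subgroup G => H ≤ N ∧ (∀ x ∈ N, x ^ p ∈ H) ∧
      ∀ x ∈ H, x ∈ frattini G → ∃ y ∈ N, y ^ p = x) (a := N.powersSubgroup p) (by
        refine ⟨?_, ?_, ?_⟩
        · intro x hx
          obtain ⟨y, hy, rfl⟩ := (mem_powersSubgroup_iff p N x).mp hx
          exact N.pow_mem hy p
        · exact fun x hx => (mem_powersSubgroup_iff p N _).mpr ⟨x, hx, rfl⟩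
        · exact fun x hx _ => (mem_powersSubgroup_iff p N x).mp hx)
  obtain ⟨⟨h1, h2, h3⟩, hmax⟩ := hH
  refine ⟨H, h1, h2, h3, fun z hz => ?_⟩
  have hnorm : H.Normal := by
    refine ⟨fun x hx g => ?_⟩
    obtain ⟨w, hw, hw'⟩ := hN x (h1 hx) g⁻¹
    have := H.mul_mem hx (h2 w hw)
    rw [hw'] at this
    convert this using 1
    group
  suffices h : z ∈ H ⊔ frattini G by
    obtain ⟨a, ha, d, hd, hz⟩ := Subgroup.mem_sup_of_normal_right.mp h
    exact ⟨a, ha, d, hd, hz⟩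
  by_contra hcon
  -- Adjoining `z` to `H` stays admissible: if `a * z ^ n ∈ Φ(G)` with `a ∈ H`, then either `p ∣ n`
  -- and `z ^ n ∈ H`, or Bézout puts `z` in `H ⊔ Φ(G)`.
  refine hcon (Subgroup.mem_sup_left (hmax (y := H ⊔ Subgroup.zpowers z) ⟨?_, ?_, ?_⟩ le_sup_left
    (Subgroup.mem_sup_right (Subgroup.mem_zpowers z))))
  · exact sup_le h1 (by simpa using hz)
  · exact fun x hx => Subgroup.mem_sup_left (h2 x hx)
  · intro x hx hxf
    obtain ⟨a, ha, b, hb, rfl⟩ := Subgroup.mem_sup_of_normal_left.mp hx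
    obtain ⟨n, rfl⟩ := Subgroup.mem_zpowers_iff.mp hb
    have hzn : z ^ n ∈ H ⊔ frattini G := by
      have := Subgroup.mul_mem_sup (H.inv_mem ha) hxf
      rwa [inv_mul_cancel_left] at this
    have hzp : z ^ (p : ℤ) ∈ H := by
      rw [zpow_natCast]
      exact h2 z hz
    by_cases hpn : (p : ℤ) ∣ n
    · obtain ⟨m, rfl⟩ := hpn
      refine h3 _ (H.mul_mem ha ?_) hxf
      rw [zpow_mul]
      exact H.zpow_mem hzp m
    · exfalso
      have hco : IsCoprime (p : ℤ) n :=
        (Nat.prime_iff_prime_int.mp hG.prime).coprime_iff_not_dvd.mpr hpn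
      obtain ⟨u, v, huv⟩ := hco
      refine hcon ?_
      have : z = (z ^ (p : ℤ)) ^ u * (z ^ n) ^ v := by
        rw [← zpow_mul, ← zpow_mul, ← zpow_add, mul_comm (p : ℤ), mul_comm n, huv, zpow_one]
      rw [this]
      exact mul_mem (zpow_mem (Subgroup.mem_sup_left hzp) u) (zpow_mem hzn v)

end IsOddUCSExpSq

/-! ### The complement `H` is UCS -/

namespace IsOddUCSExpSq

theorem IsPowerComplement.exists_pow_eq' {p : ℕ} {G : Type*} [Group G] [hG : IsOddUCSExpSq p G]
    {N H : Subgroup G} (hH : IsPowerComplement p N H) {x : G} (hx : x ∈ H)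
    (hxf : x ∈ frattini G) : ∃ y ∈ H, y ^ p = x := by
  obtain ⟨y, hy, rfl⟩ := hH.exists_pow_eq x hx hxf
  obtain ⟨h, hh, d, hd, rfl⟩ := hH.exists_mul_eq y hy
  refine ⟨h, hh, ?_⟩
  rw [mul_pow_p p, (pow_eq_one_iff_mem_frattini p d).mpr hd, mul_one]

section Retraction

variable {p : ℕ} {G : Type*} [Group G] [hG : IsOddUCSExpSq p G] {N H : Subgroup G}

theorem map_mem_frattini_of_mem_frattini (p : ℕ) {G : Type*} [Group G]
    [hG : IsOddUCSExpSq p G] {H : Subgroup G} (π : G →* H) {x : G} (hx : x ∈ frattini G) :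
    (π x : G) ∈ frattini G := by
  have h := congrArg π ((pow_eq_one_iff_mem_frattini p x).mpr hx)
  rw [map_pow, map_one, Subtype.ext_iff] at h
  exact (pow_eq_one_iff_mem_frattini p _).mp h

/-- An automorphism of `G` that fixes `N` agrees modulo the Frattini subgroup with an automorphism
of `H`. -/
theorem IsPowerComplement.exists_mulEquiv (hH : IsPowerComplement p N H) (π : G →* H)
    (hπ : ∀ h : H, π h = h) (φ : G ≃* G) (hφ : N.map φ.toMonoidHom = N) :
    ∃ β : H ≃* H, ∀ h : H, β h = π (φ h) := by
  have := hG.finite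
  have hφN : ∀ x ∈ N, φ x ∈ N := fun x hx => hφ ▸ (⟨x, hx, rfl⟩ : φ x ∈ N.map φ.toMonoidHom)
  let β : H →* H := π.comp (φ.toMonoidHom.comp H.subtype)
  have hinj : Function.Injective β := by
    rw [injective_iff_map_eq_one]
    intro h hh
    change π (φ h) = 1 at hh
    obtain ⟨a, ha, d, hd, had⟩ := hH.exists_mul_eq _ (hφN h (hH.le h.2))
    have h1 : φ h ∈ frattini G := by
      rw [← had] at hh ⊢
      rw [map_mul, hπ ⟨a, ha⟩, mul_eq_one_iff_eq_inv] at hh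
      refine mul_mem ?_ hd
      have := congrArg Subtype.val hh
      change a = ((π d)⁻¹ : H) at this
      rw [this]
      exact inv_mem (map_mem_frattini_of_mem_frattini p π hd)
    have h2 : (h : G) ∈ frattini G := by simpa using apply_mem_frattini φ.symm h1
    -- Now `h` is a `p`-th power from `H`, so `φ h` is one too; `π` fixes it, and `π (φ h) = 1`
    -- forces `φ h = 1`.
    obtain ⟨y, hy, hyh⟩ := hH.exists_pow_eq' h.2 h2
    obtain ⟨a, ha, d, hd, had⟩ := hH.exists_mul_eq _ (hφN y (hH.le hy))
    have h3 : φ h = a ^ p := by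
      rw [← hyh, map_pow, ← had, mul_pow_p p, (pow_eq_one_iff_mem_frattini p d).mpr hd, mul_one]
    rw [h3, hπ ⟨a ^ p, H.pow_mem ha p⟩, Subtype.ext_iff] at hh
    change a ^ p = 1 at hh
    rw [hh] at h3
    exact Subtype.ext ((map_eq_one_iff φ φ.injective).mp h3)
  exact ⟨MulEquiv.ofBijective β (Finite.injective_iff_bijective.mp hinj), fun h => rfl⟩

/-- The elements of `G` whose automorphic images all project into `K (H ∩ Φ(G))` form a
characteristic subgroup. It contains `K`: automorphisms fixing `N` induce automorphisms of `H`, the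
others project `H` into `Φ(G)`. Hence it is `G`, so `K (H ∩ Φ(G)) = H`; taking `p`-th powers gives
`H ∩ Φ(G) ≤ K`. -/
theorem IsPowerComplement.eq_top_of_characteristic (hH : IsPowerComplement p N H) (π : G →* H)
    (hπ : ∀ h : H, π h = h)
    (hπ' : ∀ φ : G ≃* G, N.map φ.toMonoidHom ≠ N → ∀ h : H, (π (φ h) : G) ∈ frattini G)
    {K : Subgroup H} (hK : K.Characteristic) (hKf : ∃ k ∈ K, (k : G) ∉ frattini G) : K = ⊤ := by
  let L : Subgroup H := K ⊔ (frattini G).comap H.subtype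
  have hfn : ((frattini G).comap H.subtype).Normal := inferInstance
  let M : Subgroup G := ⨅ φ : G ≃* G, L.comap (π.comp φ.toMonoidHom)
  have hM : ∀ x, x ∈ M ↔ ∀ φ : G ≃* G, π (φ x) ∈ L := fun x => by
    simp [M, Subgroup.mem_iInf]
  have hKM : ∀ k ∈ K, (k : G) ∈ M := by
    intro k hk
    rw [hM]
    intro φ
    by_cases hφ : N.map φ.toMonoidHom = N
    · obtain ⟨β, hβ⟩ := hH.exists_mulEquiv π hπ φ hφ
      rw [← hβ]
      refine Subgroup.mem_sup_left ?_
      rw [← hK.fixed β] at hk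
      exact hk
    · exact Subgroup.mem_sup_right (hπ' φ hφ k)
  have hMtop : M = ⊤ := by
    refine IsOddUCSExpSq.eq_top_of_characteristic p ?_ ?_
    · rw [Subgroup.characteristic_iff_le_comap]
      intro ψ x hx
      rw [Subgroup.mem_comap, hM]
      intro φ
      exact (hM x).mp hx (ψ.trans φ)
    · obtain ⟨k, hk, hkf⟩ := hKf
      exact fun hle => hkf (hle (hKM k hk))
  have hL : ∀ h : H, h ∈ L := fun h => by
    have := (hM h).mp (hMtop ▸ Subgroup.mem_top _) (MulEquiv.refl G)
    simpa [hπ] using this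
  refine eq_top_iff.mpr fun h _ => ?_
  obtain ⟨k, hk, d, hd, rfl⟩ := Subgroup.mem_sup_of_normal_right.mp (hL h)
  refine K.mul_mem hk ?_
  obtain ⟨y, hy, hyd⟩ := hH.exists_pow_eq' d.2 hd
  obtain ⟨l, hl, c, hc, hlc⟩ := Subgroup.mem_sup_of_normal_right.mp (hL ⟨y, hy⟩)
  have : d = l ^ p := by
    apply Subtype.ext
    have h1 : (l : G) * c = y := congrArg Subtype.val hlc
    rw [← hyd, ← h1, mul_pow_p p, (pow_eq_one_iff_mem_frattini p (c : G)).mpr hc, mul_one]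
    rfl
  rw [this]
  exact K.pow_mem hl p

theorem IsPowerComplement.isUCS (hH : IsPowerComplement p N H) (hlt : frattini G < N)
    (π : G →* H) (hπ : ∀ h : H, π h = h)
    (hπ' : ∀ φ : G ≃* G, N.map φ.toMonoidHom ≠ N → ∀ h : H, (π (φ h) : G) ∈ frattini G) :
    IsUCS H := by
  let P : Subgroup H := (frattini G).comap H.subtype
  have hP : ∀ x : H, x ∈ P ↔ x ^ p = 1 := fun x => by
    rw [Subtype.ext_iff]
    exact (pow_eq_one_iff_mem_frattini p (x : G)).symm
  obtain ⟨x, hx⟩ : ∃ x : H, x ∉ P := by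
    by_contra! hc
    refine hlt.not_ge fun x hx => ?_
    obtain ⟨h, hh, d, hd, rfl⟩ := hH.exists_mul_eq x hx
    exact mul_mem (hc ⟨h, hh⟩) hd
  have main : ∀ K : Subgroup H, K.Characteristic → ¬ K ≤ P → K = ⊤ := by
    intro K hK hKP
    obtain ⟨k, hk, hkP⟩ := SetLike.not_le_iff_exists.mp hKP
    exact hH.eq_top_of_characteristic π hπ hπ' hK ⟨k, hk, hkP⟩
  have hmul : ∀ x y : H, (x * y) ^ p = x ^ p * y ^ p := fun x y =>
    Subtype.ext (mul_pow_p p (x : G) y)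
  refine ⟨P, ⟨?_, ?_, ?_⟩, ?_⟩
  · refine ⟨fun φ => ?_⟩
    ext x
    rw [Subgroup.mem_comap, hP, hP]
    simp [← map_pow]
  · intro h
    have hxp : x ^ p ∈ P := pow_mem_frattini p (x : G)
    rw [h, Subgroup.mem_bot] at hxp
    exact hx ((hP x).mpr hxp)
  · intro h
    exact hx (h ▸ Subgroup.mem_top x)
  · rintro K ⟨hK, hK1, hK2⟩
    have hKP : K ≤ P := by
      by_contra hc
      exact hK2 (main K hK hc)
    refine le_antisymm hKP fun d hd => ?_
    -- A characteristic `K` inside `P` is pulled back along the `p`-th power map; the preimage is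
    -- not inside `P`, so it is all of `H`.
    let R : Subgroup H := K.comap
      { toFun := fun x => x ^ p, map_one' := one_pow p, map_mul' := hmul }
    have hR : ∀ x, x ∈ R ↔ x ^ p ∈ K := fun x => Iff.rfl
    have hRtop : R = ⊤ := by
      refine main R ?_ ?_
      · refine ⟨fun φ => ?_⟩
        ext x
        rw [Subgroup.mem_comap, hR, hR]
        conv_rhs => rw [← hK.fixed φ]
        rw [Subgroup.mem_comap]
        simp
      · intro hle
        obtain ⟨k, hk, hk1⟩ := K.bot_or_exists_ne_one.resolve_left hK1
        obtain ⟨y, hy, hyk⟩ := hH.exists_pow_eq' k.2 (hKP hk)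
        have hyk' : (⟨y, hy⟩ : H) ^ p = k := Subtype.ext hyk
        refine hk1 ?_
        rw [← hyk', ← hP]
        exact hle ((hR _).mpr (hyk' ▸ hk))
    obtain ⟨y, hy, hyd⟩ := hH.exists_pow_eq' d.2 hd
    have hyd' : (⟨y, hy⟩ : H) ^ p = d := Subtype.ext hyd
    rw [← hyd', ← hR, hRtop]
    exact Subgroup.mem_top _

end Retraction

/-! ### The direct decomposition -/

/-- If `f y` is central, each `β i (y i)` commutes with all the copies of `H`, hence is central and
lies in `Φ(G)`. For `y` in the kernel the coordinates are then `p`-th powers, and the same argument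
applied to their roots makes them trivial. Surjectivity holds because `Φ(G)` consists of
non-generators. -/
theorem bijective_noncommPiCoprod {p : ℕ} {G : Type*} [Group G] [hG : IsOddUCSExpSq p G]
    (hna : ¬ ∀ x y : G, x * y = y * x) {N H : Subgroup G} (hH : IsPowerComplement p N H)
    {ι : Type*} [Fintype ι] (β : ι → G ≃* G)
    (hcomm : Pairwise fun i j => ∀ x y : H,
      Commute ((β i).toMonoidHom.comp H.subtype x) ((β j).toMonoidHom.comp H.subtype y))
    (hgen : ⨆ i, N.map (β i).toMonoidHom = ⊤) :
    Function.Bijective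
      (MonoidHom.noncommPiCoprod (fun i => (β i).toMonoidHom.comp H.subtype) hcomm) := by
  classical
  have := hG.finite
  set f := MonoidHom.noncommPiCoprod (fun i => (β i).toMonoidHom.comp H.subtype) hcomm
  have hsingle : ∀ i (h : H), f (Pi.mulSingle i h) = β i h := fun i h =>
    MonoidHom.noncommPiCoprod_mulSingle (N := fun _ => H)
      (fun i => (β i).toMonoidHom.comp H.subtype) i h
  have hle : ∀ (C : Subgroup G), frattini G ≤ C → (∀ i (h : H), β i h ∈ C) → C = ⊤ := by
    intro C h1 h2
    rw [eq_top_iff, ← hgen]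
    refine iSup_le fun i => ?_
    rintro _ ⟨x, hx, rfl⟩
    obtain ⟨h, hh, d, hd, rfl⟩ := hH.exists_mul_eq x hx
    change β i (h * d) ∈ C
    rw [map_mul]
    exact C.mul_mem (h2 i ⟨h, hh⟩) (h1 (apply_mem_frattini _ hd))
  have hcent : ∀ y : ι → H, f y ∈ frattini G → ∀ i, (y i : G) ∈ frattini G := by
    intro y hy i
    have h1 : Subgroup.centralizer {β i (y i)} = ⊤ := by
      refine hle _ ((frattini_le_center p G).trans (Subgroup.center_le_centralizer _)) ?_
      intro j h
      rw [Subgroup.mem_centralizer_singleton_iff]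
      by_cases hij : j = i
      · subst hij
        have h2 : f (Pi.mulSingle j h * y * (Pi.mulSingle j h)⁻¹ * y⁻¹) = 1 := by
          have := Subgroup.mem_center_iff.mp (frattini_le_center p G hy) (f (Pi.mulSingle j h))
          rw [map_mul, map_mul, map_mul, this, map_inv, map_inv]
          group
        -- The commutator with an element of the factor `j` is supported at `j`, where `f` is the
        -- injective map `β j`.
        have h3 : Pi.mulSingle j h * y * (Pi.mulSingle j h)⁻¹ * y⁻¹ =
            Pi.mulSingle j (h * y j * h⁻¹ * (y j)⁻¹) := by
          funext l
          by_cases hl : l = j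
          · subst hl
            simp
          · simp [Pi.mulSingle_eq_of_ne hl]
        rw [h3, hsingle, map_eq_one_iff _ (β j).injective] at h2
        rw [← map_mul, ← map_mul]
        congr 1
        simpa [mul_inv_eq_one, mul_inv_eq_iff_eq_mul] using h2
      · exact hcomm hij h (y i)
    have h2 : β i (y i) ∈ frattini G := by
      rw [← center_eq_frattini p hna, Subgroup.mem_center_iff]
      intro g
      exact (Subgroup.mem_centralizer_singleton_iff.mp (h1 ▸ Subgroup.mem_top g))
    simpa using apply_mem_frattini (β i).symm h2
  constructor
  · rw [injective_iff_map_eq_one]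
    intro x hx
    have h1 := hcent x (by rw [hx]; exact one_mem _)
    choose y hy hyx using fun i => hH.exists_pow_eq' (x i).2 (h1 i)
    have h2 : (fun i => (⟨y i, hy i⟩ : H)) ^ p = x := funext fun i => Subtype.ext (hyx i)
    have h3 : f (fun i => (⟨y i, hy i⟩ : H)) ∈ frattini G := by
      rw [← pow_eq_one_iff_mem_frattini p, ← map_pow, h2, hx]
    funext i
    apply Subtype.ext
    rw [← hyx]
    exact (pow_eq_one_iff_mem_frattini p _).mpr (hcent _ h3 i)
  · rw [← MonoidHom.range_eq_top]
    refine frattini_nongenerating (hle _ le_sup_right fun i h => Subgroup.mem_sup_left ?_)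
    exact ⟨_, hsingle i h⟩

theorem exists_mulEquiv_pi (p : ℕ) {G : Type u} [Group G] [hG : IsOddUCSExpSq p G]
    (hna : ¬ ∀ x y : G, x * y = y * x) {N : Subgroup G} (hpe : N.IsPowerfullyEmbedded p)
    (htop : N ≠ ⊤) (hlt : frattini G < N) :
    ∃ (k : ℕ) (H : Type u) (_ : Group H),
      2 ≤ k ∧ IsPGroup p H ∧ IsUCS H ∧ Nonempty (G ≃* (Fin k → H)) := by
  classical
  have := hG.finite
  obtain ⟨M, hMN, hM⟩ := exists_isMinimalEmbedded p hlt ((isPowerfullyEmbedded_iff p N).mp hpe)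
  have hMtop : M ≠ ⊤ := fun h => htop (top_le_iff.mp (h ▸ hMN))
  obtain ⟨H, hH⟩ := exists_isPowerComplement p hM.embedded
  -- The factors are indexed by the distinct images of `M`, not by automorphisms.
  let ι := Set.range fun φ : G ≃* G => M.map φ.toMonoidHom
  have hι : ∀ i : ι, ∃ α : G ≃* G, M.map α.toMonoidHom = i := fun i => i.2
  choose α hα using hι
  have hMmem : M.map (MulEquiv.refl G).toMonoidHom = M := by
    ext x
    simp
  let o : ι := ⟨M, MulEquiv.refl G, hMmem⟩
  -- Normalised so that `β o` is the identity; the `o`-th coordinate is then a retraction of `G`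
  -- onto `H`.
  let β : ι → G ≃* G := fun i => (α o).symm.trans (α i)
  have hβo : ∀ x, β o x = x := fun x => by simp [β]
  have hβ : ∀ i, M.map (β i).toMonoidHom = i := fun i => by
    have h1 : M.map (α o).symm.toMonoidHom = M := by
      have h2 : M.map (α o).toMonoidHom = M := hα o
      conv_lhs => rw [← h2, Subgroup.map_map]
      ext x
      simp
    rw [← hα i]
    conv_rhs => rw [← h1, Subgroup.map_map]
    rfl
  have : Fintype ι := Fintype.ofFinite ι
  have hgen : ⨆ i, M.map (β i).toMonoidHom = ⊤ := by
    rw [eq_top_iff, ← iSup_map_mulEquiv_eq_top p hM.lt.not_ge]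
    refine iSup_le fun φ => ?_
    have := hβ ⟨M.map φ.toMonoidHom, φ, rfl⟩
    rw [← show M.map (β ⟨M.map φ.toMonoidHom, φ, rfl⟩).toMonoidHom = M.map φ.toMonoidHom from this]
    exact le_iSup (fun i => M.map (β i).toMonoidHom) _
  have hcomm : Pairwise fun i j => ∀ x y : H,
      Commute ((β i).toMonoidHom.comp H.subtype x) ((β j).toMonoidHom.comp H.subtype y) := by
    intro i j hij x y
    refine (hM.map (β i)).commute (hM.map (β j)) ?_ ⟨x, hH.le x.2, rfl⟩ ⟨y, hH.le y.2, rfl⟩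
    rw [hβ, hβ]
    exact fun h => hij (Subtype.ext h)
  let e : (ι → H) ≃* G := MulEquiv.ofBijective _ (bijective_noncommPiCoprod hna hH β hcomm hgen)
  have he : ∀ i (h : H), e (Pi.mulSingle i h) = β i h := fun i h =>
    MonoidHom.noncommPiCoprod_mulSingle (N := fun _ => H) (hcomm := hcomm)
      (fun i => (β i).toMonoidHom.comp H.subtype) i h
  have he' : ∀ i (h : H), e.symm (β i h) = Pi.mulSingle i h := fun i h => by
    rw [← he, e.symm_apply_apply]
  let π : G →* H := (Pi.evalMonoidHom (fun _ : ι => H) o).comp e.symm.toMonoidHom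
  have hπ : ∀ x, π x = e.symm x o := fun x => rfl
  have hcard : 2 ≤ Fintype.card ι := by
    by_contra! hc
    have hs : Subsingleton ι := Fintype.card_le_one_iff_subsingleton.mp (by omega)
    refine hMtop (top_le_iff.mp (hgen ▸ iSup_le fun i => ?_))
    rw [hβ, Subsingleton.elim i o]
  refine ⟨Fintype.card ι, H, inferInstance, hcard, hG.isPGroup.to_subgroup H, ?_,
    ⟨e.symm.trans (MulEquiv.arrowCongr (Fintype.equivFin ι) (MulEquiv.refl H))⟩⟩
  refine hH.isUCS hM.lt π (fun h => ?_) fun φ hφ h => ?_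
  · rw [hπ]
    conv_lhs => rw [← hβo (h : G), he', Pi.mulSingle_eq_same]
  · have h1 : φ h ∈ M.map (β ⟨M.map φ.toMonoidHom, φ, rfl⟩).toMonoidHom := by
      rw [hβ]
      exact ⟨h, hH.le h.2, rfl⟩
    obtain ⟨n, hn, hn'⟩ := h1
    obtain ⟨a, ha, d, hd, rfl⟩ := hH.exists_mul_eq n hn
    have hne : o ≠ (⟨M.map φ.toMonoidHom, φ, rfl⟩ : ι) := fun h => hφ (congrArg Subtype.val h).symm
    -- `φ h` lies in an image of `M` other than `M`, so modulo `Φ(G)` it lies in a factor different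
    -- from `o`.
    have h2 : π (φ h) = π (β ⟨M.map φ.toMonoidHom, φ, rfl⟩ d) := by
      rw [← hn']
      change π (β _ (a * d)) = _
      rw [map_mul, map_mul, hπ (β _ a), he' _ ⟨a, ha⟩, Pi.mulSingle_eq_of_ne hne, one_mul]
    rw [h2]
    exact map_mem_frattini_of_mem_frattini p π (apply_mem_frattini _ hd)

end IsOddUCSExpSq

theorem mainTheorem7 (p : ℕ) (G : Type u) [Group G] [IsOddUCSExpSq p G]
    (hG : ¬ ∀ x y : G, x * y = y * x) :
    List.TFAE [
      ¬ ∃ (k : ℕ) (H : Type u) (_ : Group H),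
        2 ≤ k ∧ IsPGroup p H ∧ IsUCS H ∧ Nonempty (G ≃* (Fin k → H)),
      ¬ ∃ N : Subgroup G, N.IsPowerfullyEmbedded p ∧ N ≠ ⊤ ∧ frattini G < N,
      IsSimpleNonassocAlgebra (ZMod p) (UCSAlgebra p G)] := by
  tfae_have 1 → 2 := by
    rintro h ⟨N, hpe, htop, hlt⟩
    exact h (IsOddUCSExpSq.exists_mulEquiv_pi p hG hpe htop hlt)
  tfae_have 2 → 1 := by
    rintro h ⟨k, H, _, hk, -, -, ⟨e⟩⟩
    exact h (IsOddUCSExpSq.exists_isPowerfullyEmbedded_of_mulEquiv p hG e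
      (i := ⟨0, by omega⟩) (j := ⟨1, by omega⟩) (by simp))
  tfae_have 3 ↔ 2 := UCSAlgebra.isSimple_iff p
  tfae_finish
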